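/- Let $N\ge 2$, let $\Omega\subset\mathbb{R}^N$ be a bounded open set with Lipschitz boundary and outer unit normal $\nu$, let $T>0$, $f\in L^1(0,T;L^2(\Omega))$ and $u_0\in L^2(\Omega)$. Put $X=BV(\Omega)\cap L^2(\Omega)$, with its natural norm. **Conventions.** $L^1_w(0,T;X)$ is the set of weakly measurable $U:(0,T)\to X$ with $\int_0^T\|U(t)\|_X\,dt<\infty$; $L^1(0,T;X)$ is the set of those $U$ that are moreover Pettis integrable (all Bochner integrable maps are included). The dual $L^1(0,T;X)^*$ is identified with the space of weakly-$*$ measurable, essentially bounded maps $\zeta:(0,T)\to X^*$. For $\xi=\zeta+g$ with $\zeta\in L^1(0,T;X)^*$ and $g\in L^1(0,T;L^2(\Omega))$ write $\langle\!\langle\xi(t),v\rangle\!\rangle=\langle\zeta(t),v\rangle+\int_\Omega g(t)v\,dx$ for $v\in X$. **Time derivative.** $\xi\in L^1(0,T;X)^*+L^1(0,T;L^2(\Omega))$ is the time derivative of $u$ if $$\int_0^T\langle\!\langle\xi(t),\Psi(t)\rangle\!\rangle\,dt=-\int_0^T\int_\Omega u(t)\,\Theta(t)\,dx\,dt$$ for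 every $\Psi\in L^1(0,T;X)\cap L^\infty(0,T;L^2(\Omega))$ with compact support in $(0,T)$ such that $\Psi(t)=\int_0^t\Theta(s)\,ds$ (Pettis integral in $X$) for all $t\in[0,T]$, for some $\Theta\in L^1_w(0,T;X)$. **Solution.** $u$ is a solution, with time derivative $\xi$, of $u'-\Delta_1u=f$ in $(0,T)\times\Omega$, $u=0$ on $(0,T)\times\partial\Omega$, $u(0)=u_0$, if $u\in C([0,T];L^2(\Omega))\cap L^1(0,T;X)$, $u(0)=u_0$, $\xi\in L^1(0,T;X)^*+L^1(0,T;L^2(\Omega))$ is the time derivative of $u$, and there is $\mathbf z\in L^\infty((0,T)\times\Omega;\mathbb{R}^N)$ with $\|\mathbf z\|_\infty\le1$ whose distributional (spatial) divergence has an extension $\rho\in L^1(0,T;X)^*$ such that for almost every $t\in(0,T)$: * the weak normal trace $[\mathbf z(t),\nu]\in L^\infty(\partial\Omega)$ is well defined by $\langle\rho(t),v\rangle+\int_\Omega\mathbf z(t)\cdot\nabla v\,dx=\int_{\partial\Omega}v\,[\mathbf z(t),\nu]\,d\mathcal H^{N-1}$ for all $v\in W^{1,1}(\Omega)\cap L^\infty(\Omega)$,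 and $\|[\mathbf z(t),\nu]\|_\infty\le1$; * for every $v\in X$ the distribution $\langle(\mathbf z(t),Dv),\omega\rangle=-\langle\rho(t),v\omega\rangle-\int_\Omega v\,\mathbf z(t)\cdot\nabla\omega\,dx$, $\omega\in C_0^\infty(\Omega)$, is a finite Radon measure, and $\langle\rho(t),v\rangle+\int_\Omega(\mathbf z(t),Dv)=\int_{\partial\Omega}v\,[\mathbf z(t),\nu]\,d\mathcal H^{N-1}$; * $\xi(t)=\operatorname{div}\mathbf z(t)+f(t)$ in $\mathcal D'(\Omega)$; $(\mathbf z(t),Du(t))=|Du(t)|$ as measures in $\Omega$; $[\mathbf z(t),\nu]\in\operatorname{sign}(-u(t))$ $\mathcal H^{N-1}$-a.e. on $\partial\Omega$; and $\langle\!\langle\xi(t),u(t)\rangle\!\rangle=\frac12\left(\int_\Omega u(t)^2\,dx\right)'$ in the sense of distributions on $(0,T)$. **Claim.** Let $u$ be a solution with time derivative $\xi$, and let $\eta\in C_0^\infty(0,T)$ be nonnegative; extend $\eta u$ by $0$ outside $(0,T)$. For every $\varepsilon>0$ and $t\in(0,T)$ the function $\eta u$ is Pettis integrable in $X$ on $(t-\varepsilon,t)$,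 the function $t\mapsto\big\langle\!\big\langle\xi(t),\frac1\varepsilon\int_{t-\varepsilon}^t\eta(s)u(s)\,ds\big\rangle\!\big\rangle$ is integrable on $(0,T)$, and $$\lim_{\varepsilon\to0^+}\int_0^T\Big\langle\!\!\Big\langle\xi(t),\frac1\varepsilon\int_{t-\varepsilon}^t\eta(s)u(s)\,ds\Big\rangle\!\!\Big\rangle\,dt=-\int_0^T\eta'(t)\int_\Omega\tfrac12u(t)^2\,dx\,dt .$$ -/

import Mathlib

open MeasureTheory Set Filter Topology TopologicalSpace Distributions
open scoped NNReal ENNReal Gradient InnerProductSpace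

noncomputable section

namespace TVFlow

/-- The Euclidean space `ℝ^N`. -/
abbrev E (N : ℕ) : Type := EuclideanSpace ℝ (Fin N)

variable {N : ℕ}

/-- Lebesgue measure on `Ω`. -/
abbrev volOn (Ω : Opens (E N)) : Measure (E N) := volume.restrict (Ω : Set (E N))

/-- The space `L²(Ω)`. -/
abbrev L2 (Ω : Opens (E N)) : Type := Lp ℝ 2 (volOn Ω)

/-- The open time interval `(0,T)`, as an open set. -/
def timeInterval (T : ℝ) : Opens ℝ := ⟨Ioo 0 T, isOpen_Ioo⟩

/-- The surface measure: the `(N-1)`-dimensional Hausdorff measure, with the Euclidean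
normalization, on the boundary of `Ω`. -/
def bdryMeasure (Ω : Opens (E N)) : Measure (E N) :=
  (Measure.euclideanHausdorffMeasure (N - 1)).restrict (frontier (Ω : Set (E N)))

/-- `Ω` has Lipschitz boundary: near each boundary point `Ω` is, in suitable orthogonal coordinates
(with last axis `n`), the set of points strictly above the graph of a Lipschitz function. -/
def HasLipschitzBoundary (Ω : Opens (E N)) : Prop :=
  ∀ x ∈ frontier (Ω : Set (E N)), ∃ n : E N, ‖n‖ = 1 ∧ ∃ r > 0, ∃ (K : ℝ≥0)
    (g : (Submodule.span ℝ {n})ᗮ → ℝ), LipschitzWith K g ∧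
      ∀ y ∈ Metric.ball x r,
        (y ∈ Ω ↔ g ((Submodule.span ℝ {n})ᗮ.orthogonalProjectionOnto y) < ⟪n, y⟫_ℝ)

/-! ### Functions of bounded variation -/

/-- The `ℝ^N`-valued measure `D` on `Ω` (a measure on `ℝ^N` concentrated on `Ω`) has finite total
variation and is the distributional gradient of `v` in `Ω`. -/
structure IsGradMeasure (Ω : Opens (E N)) (v : E N → ℝ) (D : VectorMeasure (E N) (E N)) :
    Prop where
  finite : IsFiniteMeasure D.variation
  concentrated : ∀ A, MeasurableSet A → D A = D (A ∩ Ω)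
  integral_eq : ∀ φ : 𝓓(Ω, ℝ), ∫ x in (Ω : Set (E N)), v x • ∇ φ x = - ∫ᵛ x, φ x ∂•D

lemma integrable_test {Ω : Opens (E N)} {D : VectorMeasure (E N) (E N)}
    (hD : IsFiniteMeasure D.variation) (φ : 𝓓(Ω, ℝ)) : D.Integrable φ :=
  φ.continuous.integrable_of_hasCompactSupport φ.hasCompactSupport

lemma exists_test_tendsto {Ω : Opens (E N)} {K : Set (E N)} (hK : IsCompact K)
    (hKΩ : K ⊆ Ω) : ∃ φ : ℕ → 𝓓(Ω, ℝ), (∀ n x, ‖φ n x‖ ≤ 1) ∧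
      ∀ x, Tendsto (fun n => φ n x) atTop (𝓝 (K.indicator (fun _ => (1 : ℝ)) x)) := by
  obtain ⟨δ, δpos, hδ⟩ := hK.exists_cthickening_subset_open Ω.isOpen hKΩ
  obtain ⟨u, -, u_pos, u_lim⟩ : ∃ u, StrictAnti u ∧ (∀ (n : ℕ), u n ∈ Ioo 0 δ)
    ∧ Tendsto u atTop (𝓝 0) := exists_seq_strictAnti_tendsto' δpos
  have key : ∀ n, ∃ φ : 𝓓(Ω, ℝ), (∀ x, ‖φ x‖ ≤ 1) ∧ (∀ x ∈ K, φ x = 1) ∧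
      ∀ x, x ∉ Metric.thickening (u n) K → φ x = 0 := by
    intro n
    rcases exists_contMDiff_support_eq_eq_one_iff (modelWithCornersSelf ℝ (E N)) (n := (⊤ : ℕ∞))
      (Metric.isOpen_thickening (δ := u n) (E := K)) hK.isClosed
      (Metric.self_subset_thickening (u_pos n).1 K) with ⟨g, g_smooth, g_range, g_supp, hg⟩
    have hsub : tsupport g ⊆ Metric.cthickening δ K := by
      refine closure_minimal ?_ Metric.isClosed_cthickening
      rw [g_supp]
      exact Metric.thickening_subset_cthickening_of_le (u_pos n).2.le _
    refine ⟨⟨g, contMDiff_iff_contDiff.1 g_smooth,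
      hK.cthickening.of_isClosed_subset (isClosed_tsupport g) hsub, hsub.trans hδ⟩, ?_, ?_, ?_⟩
    · intro x
      have := g_range (mem_range_self x)
      change ‖g x‖ ≤ 1
      rw [Real.norm_of_nonneg this.1]
      exact this.2
    · exact fun x hx => (hg x).1 hx
    · intro x hx
      change g x = 0
      rwa [← Function.notMem_support, g_supp]
  choose φ h1 h2 h3 using key
  refine ⟨φ, h1, fun x => ?_⟩
  by_cases hx : x ∈ K
  · simp [hx, h2 _ x hx]
  · simp only [hx, not_false_eq_true, indicator_of_notMem]
    apply tendsto_const_nhds.congr'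
    obtain ⟨ε, εpos, hε⟩ : ∃ ε, 0 < ε ∧ x ∉ Metric.thickening ε K := by
      rw [← hK.isClosed.closure_eq, Metric.closure_eq_iInter_thickening] at hx
      simpa using hx
    filter_upwards [(tendsto_order.1 u_lim).2 _ εpos] with n hn
    exact (h3 n x fun h => hε (Metric.thickening_mono hn.le K h)).symm

/-- The distributional gradient is unique. -/
lemma IsGradMeasure.unique {Ω : Opens (E N)} {v : E N → ℝ} {D₁ D₂ : VectorMeasure (E N) (E N)}
    (h₁ : IsGradMeasure Ω v D₁) (h₂ : IsGradMeasure Ω v D₂) : D₁ = D₂ := by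
  have hcomp : ∀ K : Set (E N), IsCompact K → K ⊆ Ω → D₁ K = D₂ K := by
    intro K hK hKΩ
    obtain ⟨φ, hb, hl⟩ := exists_test_tendsto hK hKΩ
    have lim : ∀ D : VectorMeasure (E N) (E N), IsGradMeasure Ω v D →
        Tendsto (fun n => - ∫ x in (Ω : Set (E N)), v x • ∇ (φ n) x) atTop (𝓝 (D K)) := by
      intro D h
      have := h.finite
      have h0 : ∫ᵛ x, K.indicator (fun _ => (1 : ℝ)) x ∂•D = D K := by
        rw [VectorMeasure.integral_indicator hK.measurableSet, VectorMeasure.integral_const]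
        simp
      simp_rw [h.integral_eq, neg_neg]
      rw [← h0]
      exact VectorMeasure.tendsto_integral_of_dominated_convergence (fun _ => (1 : ℝ))
        (fun n => (φ n).continuous.aestronglyMeasurable) (integrable_const _)
        (fun n => Eventually.of_forall (hb n)) (Eventually.of_forall hl)
    exact tendsto_nhds_unique (lim D₁ h₁) (lim D₂ h₂)
  have hclosed : ∀ F : Set (E N), IsClosed F → D₁ F = D₂ F := by
    intro F hF
    obtain ⟨C, hCc, hCs, hCu, hCm⟩ := Ω.isOpen.exists_iUnion_isClosed
    set K : ℕ → Set (E N) := fun n => F ∩ (C n ∩ Metric.closedBall 0 n) with hKdef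
    have hKc : ∀ n, IsCompact (K n) := fun n =>
      ((isCompact_closedBall 0 (n : ℝ)).inter_left (hCc n)).inter_left hF
    have hKm : Monotone K := by
      intro m n hmn
      have : (m : ℝ) ≤ n := by exact_mod_cast hmn
      exact inter_subset_inter_right _
        (inter_subset_inter (hCm hmn) (Metric.closedBall_subset_closedBall this))
    have hKu : ⋃ n, K n = F ∩ Ω := by
      ext x
      simp only [hKdef, mem_iUnion, mem_inter_iff, Metric.mem_closedBall, dist_zero_right]
      constructor
      · rintro ⟨n, h1, h2, -⟩
        exact ⟨h1, hCs n h2⟩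
      · rintro ⟨h1, h2⟩
        rw [← hCu] at h2
        obtain ⟨m, hm⟩ := mem_iUnion.1 h2
        obtain ⟨k, hk⟩ := exists_nat_ge ‖x‖
        refine ⟨max m k, h1, hCm (le_max_left _ _) hm, hk.trans ?_⟩
        exact_mod_cast le_max_right _ _
    rw [h₁.concentrated F hF.measurableSet, h₂.concentrated F hF.measurableSet, ← hKu]
    have l1 := D₁.tendsto_vectorMeasure_iUnion_atTop_nat hKm (fun n => (hKc n).measurableSet)
    have l2 := D₂.tendsto_vectorMeasure_iUnion_atTop_nat hKm (fun n => (hKc n).measurableSet)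
    refine tendsto_nhds_unique l1 (l2.congr fun n => ?_)
    exact (hcomp _ (hKc n) fun x hx => hCs n hx.2.1).symm
  exact VectorMeasure.ext_of_generateFrom {s | IsClosed s} (fun s hs => hclosed s hs)
    (by rw [← borel_eq_generateFrom_isClosed]; exact BorelSpace.measurable_eq)
    isPiSystem_isClosed (hclosed _ isClosed_univ)

lemma integrable_smul_gradient {Ω : Opens (E N)} (v : L2 Ω) (φ : 𝓓(Ω, ℝ)) :
    Integrable (fun x => v x • ∇ φ x) (volOn Ω) := by
  have hc : Continuous (∇ φ) :=
    (InnerProductSpace.toDual ℝ (E N)).symm.continuous.comp (φ.contDiff.continuous_fderiv (by simp))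
  have hs : HasCompactSupport (∇ φ) :=
    (φ.hasCompactSupport.fderiv ℝ).comp_left (g := (InnerProductSpace.toDual ℝ (E N)).symm)
      (map_zero _)
  have h2 : MemLp (∇ φ) 2 (volOn Ω) := hc.memLp_of_hasCompactSupport hs
  exact memLp_one_iff_integrable.1 (h2.smul (Lp.memLp v))

lemma IsGradMeasure.zero (Ω : Opens (E N)) : IsGradMeasure Ω ((0 : L2 Ω) : E N → ℝ) 0 where
  finite := by rw [VectorMeasure.variation_zero]; infer_instance
  concentrated A _ := by simp
  integral_eq φ := by
    rw [VectorMeasure.integral_zero_vectorMeasure, neg_zero]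
    refine integral_eq_zero_of_ae ?_
    filter_upwards [Lp.coeFn_zero ℝ 2 (volOn Ω)] with x hx
    rw [hx]
    exact zero_smul ℝ _

lemma IsGradMeasure.add {Ω : Opens (E N)} {v w : L2 Ω} {D₁ D₂ : VectorMeasure (E N) (E N)}
    (h₁ : IsGradMeasure Ω v D₁) (h₂ : IsGradMeasure Ω w D₂) :
    IsGradMeasure Ω (v + w : L2 Ω) (D₁ + D₂) where
  finite := by
    have := h₁.finite
    have := h₂.finite
    exact isFiniteMeasure_of_le _ VectorMeasure.variation_add_le
  concentrated A hA := by
    simp only [_root_.add_apply]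
    rw [h₁.concentrated A hA, h₂.concentrated A hA]
  integral_eq φ := by
    rw [VectorMeasure.integral_add_vectorMeasure (integrable_test h₁.finite φ)
      (integrable_test h₂.finite φ), neg_add, ← h₁.integral_eq, ← h₂.integral_eq,
      ← integral_add (integrable_smul_gradient v φ) (integrable_smul_gradient w φ)]
    refine integral_congr_ae ?_
    filter_upwards [Lp.coeFn_add v w] with x hx
    rw [hx]
    exact add_smul _ _ _

lemma IsGradMeasure.smul {Ω : Opens (E N)} {v : L2 Ω} {D : VectorMeasure (E N) (E N)} (c : ℝ)
    (h : IsGradMeasure Ω v D) : IsGradMeasure Ω (c • v : L2 Ω) (c • D) where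
  finite := by
    have := h.finite
    infer_instance
  concentrated A hA := by
    simp only [_root_.smul_apply]
    rw [h.concentrated A hA]
  integral_eq φ := by
    rw [VectorMeasure.integral_smul_vectorMeasure, ← smul_neg, ← h.integral_eq, ← integral_smul]
    refine integral_congr_ae ?_
    filter_upwards [Lp.coeFn_smul c v] with x hx
    rw [hx]
    exact mul_smul c (v x) _

/-- `BV(Ω) ∩ L²(Ω)` as a linear subspace of `L²(Ω)` (for bounded `Ω`, every function in `L²(Ω)` is
integrable). -/
def bvSubmodule (Ω : Opens (E N)) : Submodule ℝ (L2 Ω) where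
  carrier := {v | ∃ D, IsGradMeasure Ω v D}
  zero_mem' := ⟨0, IsGradMeasure.zero Ω⟩
  add_mem' := fun ⟨_, h₁⟩ ⟨_, h₂⟩ => ⟨_, h₁.add h₂⟩
  smul_mem' := fun c _ ⟨_, h⟩ => ⟨_, h.smul c⟩

/-- The space `BV(Ω) ∩ L²(Ω)`, which gets its own norm below. -/
def BVL2 (Ω : Opens (E N)) : Type := bvSubmodule Ω

namespace BVL2

variable {Ω : Opens (E N)}

instance : AddCommGroup (BVL2 Ω) := inferInstanceAs (AddCommGroup (bvSubmodule Ω))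
instance : Module ℝ (BVL2 Ω) := inferInstanceAs (Module ℝ (bvSubmodule Ω))

/-- The inclusion of `BV(Ω) ∩ L²(Ω)` in `L²(Ω)`. -/
def toL2 : BVL2 Ω →ₗ[ℝ] L2 Ω := (bvSubmodule Ω).subtype

/-- The distributional gradient `Dv`, an `ℝ^N`-valued measure. -/
def grad (v : BVL2 Ω) : VectorMeasure (E N) (E N) := v.2.choose

lemma isGradMeasure_grad (v : BVL2 Ω) : IsGradMeasure Ω (toL2 v) (grad v) := v.2.choose_spec

lemma grad_eq {v : BVL2 Ω} {D : VectorMeasure (E N) (E N)} (h : IsGradMeasure Ω (toL2 v) D) :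
    grad v = D := (isGradMeasure_grad v).unique h

/-- The total variation measure `|Dv|`. -/
def tv (v : BVL2 Ω) : Measure (E N) := (grad v).variation

instance (v : BVL2 Ω) : IsFiniteMeasure (tv v) := (isGradMeasure_grad v).finite

/-- The norm `‖v‖ = |Dv|(Ω) + ‖v‖_{L²(Ω)}`; for bounded `Ω` it is equivalent to
`max {|Dv|(Ω) + ‖v‖_{L¹(Ω)}, ‖v‖_{L²(Ω)}}`. -/
instance : Norm (BVL2 Ω) := ⟨fun v => (tv v).real Ω + ‖toL2 v‖⟩

lemma norm_def (v : BVL2 Ω) : ‖v‖ = (tv v).real Ω + ‖toL2 v‖ := rfl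

lemma normCore : NormedSpace.Core ℝ (BVL2 Ω) where
  norm_nonneg v := by rw [norm_def]; positivity
  norm_smul c v := by
    have h : grad (c • v) = c • grad v := by
      apply grad_eq
      rw [map_smul]
      exact (isGradMeasure_grad v).smul c
    rw [norm_def, norm_def, map_smul, norm_smul, mul_add, tv, tv, h, VectorMeasure.variation_smul]
    simp [Measure.real]
  norm_triangle v w := by
    have h : grad (v + w) = grad v + grad w := by
      apply grad_eq
      rw [map_add]
      exact (isGradMeasure_grad v).add (isGradMeasure_grad w)
    have h1 : (tv (v + w)).real Ω ≤ (tv v).real Ω + (tv w).real Ω := by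
      rw [← measureReal_add_apply]
      refine ENNReal.toReal_mono (measure_ne_top _ _) ?_
      rw [tv, h]
      exact VectorMeasure.variation_add_le _
    have h2 := norm_add_le (toL2 v) (toL2 w)
    rw [norm_def, norm_def, norm_def, map_add]
    linarith
  norm_eq_zero_iff v := by
    constructor
    · intro h
      rw [norm_def] at h
      have h0 : 0 ≤ (tv v).real Ω := measureReal_nonneg
      have h1 : ‖toL2 v‖ = 0 := le_antisymm (by linarith) (norm_nonneg _)
      exact Subtype.ext (norm_eq_zero.1 h1)
    · rintro rfl
      have h : grad (0 : BVL2 Ω) = 0 := by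
        apply grad_eq
        rw [map_zero]
        exact IsGradMeasure.zero Ω
      rw [norm_def, map_zero, tv, h]
      simp

instance : NormedAddCommGroup (BVL2 Ω) := NormedAddCommGroup.ofCore normCore
instance : NormedSpace ℝ (BVL2 Ω) := NormedSpace.ofCore normCore

end BVL2

open BVL2

/-- The element of `BV(Ω) ∩ L²(Ω)` that is a.e. equal to the given function on `Ω` (and `0` if the
function does not belong to that space). -/
def toBV (Ω : Opens (E N)) (f : E N → ℝ) : BVL2 Ω :=
  open Classical in if h : ∃ v : BVL2 Ω, toL2 v =ᵐ[volOn Ω] f then h.choose else 0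

/-- The trace on `∂Ω`: for functions of bounded variation on a bounded Lipschitz domain the limit
of averages exists at almost every boundary point. -/
def bdryTrace (Ω : Opens (E N)) (v : E N → ℝ) (x : E N) : ℝ :=
  limUnder (𝓝[>] (0 : ℝ)) fun r => ⨍ y in (Ω : Set (E N)) ∩ Metric.ball x r, v y

/-- `G` is the weak gradient of `v` in `Ω`, and it is integrable. -/
def HasIntegrableWeakGradient (Ω : Opens (E N)) (v : E N → ℝ) (G : E N → E N) : Prop :=
  IntegrableOn G Ω ∧
    ∀ φ : 𝓓(Ω, ℝ), ∫ x in (Ω : Set (E N)), v x • ∇ φ x = - ∫ x in (Ω : Set (E N)), φ x • G x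

/-! ### Integration of vector-valued functions of time -/

section Pettis

variable {X : Type*} [NormedAddCommGroup X] [NormedSpace ℝ X]

/-- `v` is the Pettis integral of `U` over `S`. -/
def HasPettisIntegral (U : ℝ → X) (S : Set ℝ) (v : X) : Prop :=
  ∀ l : StrongDual ℝ X, IntegrableOn (fun t => l (U t)) S ∧ ∫ t in S, l (U t) = l v

/-- `U` is Pettis integrable on `S`. -/
def PettisIntegrableOn (U : ℝ → X) (S : Set ℝ) : Prop :=
  ∀ A, MeasurableSet A → A ⊆ S → ∃ v, HasPettisIntegral U A v

/-- The Pettis integral of `U` over `S` (and `0` if there is none). -/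
def pettisIntegral (U : ℝ → X) (S : Set ℝ) : X :=
  open Classical in if h : ∃ v, HasPettisIntegral U S v then h.choose else 0

/-- `U` is a weakly measurable map on `(0,T)` with `∫₀ᵀ ‖U(t)‖ dt < ∞`. -/
def MemL1w (T : ℝ) (U : ℝ → X) : Prop :=
  (∀ l : StrongDual ℝ X, AEMeasurable (fun t => l (U t)) (volume.restrict (Ioo 0 T))) ∧
    ∫⁻ t in Ioo 0 T, ‖U t‖ₑ < ∞

/-- `U` is a weakly measurable and Pettis integrable map on `(0,T)` with `∫₀ᵀ ‖U(t)‖ dt < ∞`.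
Every Bochner integrable map satisfies this. -/
def MemL1 (T : ℝ) (U : ℝ → X) : Prop := MemL1w T U ∧ PettisIntegrableOn U (Ioo 0 T)

/-- `ζ ∈ L^∞_{w*}(0,T;X*)`, which is the dual of `L¹(0,T;X)`: `ζ` is weakly-* measurable and
essentially bounded. -/
def MemDualL1 (T : ℝ) (ζ : ℝ → StrongDual ℝ X) : Prop :=
  (∀ v : X, AEMeasurable (fun t => ζ t v) (volume.restrict (Ioo 0 T))) ∧
    ∃ C : ℝ, ∀ᵐ t ∂volume.restrict (Ioo 0 T), ‖ζ t‖ ≤ C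

/-- `Θ` is the weak derivative of `Ψ` on `[0,T]`: `Ψ(t) = ∫₀ᵗ Θ(s) ds` as a Pettis integral. -/
def IsWeakDerivative (T : ℝ) (Ψ Θ : ℝ → X) : Prop :=
  MemL1w T Θ ∧ PettisIntegrableOn Θ (Ioo 0 T) ∧
    ∀ t ∈ Icc 0 T, HasPettisIntegral Θ (Ioo 0 t) (Ψ t)

end Pettis

/-- `ξ` belongs to `L¹(0,T;BV(Ω) ∩ L²(Ω))* + L¹(0,T;L²(Ω))`. The element `ξ(t) = ζ(t) + g(t)` acts on
`v` by `⟨ζ(t), v⟩ + ∫_Ω g(t) v dx`. -/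
def MemDualL1AddL1 (Ω : Opens (E N)) (T : ℝ) (ξ : ℝ → StrongDual ℝ (BVL2 Ω)) : Prop :=
  ∃ (ζ : ℝ → StrongDual ℝ (BVL2 Ω)) (g : ℝ → L2 Ω), MemDualL1 T ζ ∧ IntegrableOn g (Ioo 0 T) ∧
    ∀ᵐ t ∂volume.restrict (Ioo 0 T), ∀ v : BVL2 Ω,
      ξ t v = ζ t v + ∫ x in (Ω : Set (E N)), g t x * toL2 v x

/-- `ξ` is the time derivative of `u`: for every test function `Ψ` with compact support in time
which admits a weak derivative `Θ`, one has `∫₀ᵀ ⟨⟨ξ, Ψ⟩⟩ dt = - ∫₀ᵀ ∫_Ω u Θ dx dt`. -/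
def IsTimeDerivative (Ω : Opens (E N)) (T : ℝ) (u : ℝ → L2 Ω) (ξ : ℝ → StrongDual ℝ (BVL2 Ω)) :
    Prop :=
  ∀ Ψ Θ : ℝ → BVL2 Ω, MemL1 T Ψ →
    (∃ C : ℝ, ∀ᵐ t ∂volume.restrict (Ioo 0 T), ‖toL2 (Ψ t)‖ ≤ C) →
    (∃ a b : ℝ, 0 < a ∧ b < T ∧ ∀ t ∈ Icc 0 T, t ∉ Icc a b → Ψ t = 0) →
    IsWeakDerivative T Ψ Θ →
    ∫ t in Ioo 0 T, ξ t (Ψ t) =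
      - ∫ t in Ioo 0 T, ∫ x in (Ω : Set (E N)), u t x * toL2 (Θ t) x

/-! ### Solutions of the `1`-Laplace evolution equation -/

/-- The multivalued sign. -/
def signSet (s : ℝ) : Set ℝ :=
  {a | (0 < s → a = 1) ∧ (s < 0 → a = -1) ∧ |a| ≤ 1}

/-- The distribution `(z, Dv)` when the divergence of `z` is extended to `ρ ∈ (BV(Ω) ∩ L²(Ω))*`:
`⟨(z, Dv), ω⟩ = - ⟨ρ, v ω⟩ - ∫_Ω v z · ∇ω dx`. -/
def pairing (Ω : Opens (E N)) (z : E N → E N) (ρ : StrongDual ℝ (BVL2 Ω)) (v : BVL2 Ω)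
    (ω : 𝓓(Ω, ℝ)) : ℝ :=
  - ρ (toBV Ω fun x => toL2 v x * ω x) - ∫ x in (Ω : Set (E N)), toL2 v x * ⟪z x, ∇ ω x⟫_ℝ

/-- `γ = [z, ν]` is the weak trace on `∂Ω` of the normal component of `z`, when the divergence of `z`
is extended to `ρ`: `⟨ρ, v⟩ + ∫_Ω z · ∇v dx = ∫_{∂Ω} v γ` for all `v ∈ W^{1,1}(Ω) ∩ L^∞(Ω)`. -/
def IsNormalTrace (Ω : Opens (E N)) (z : E N → E N) (ρ : StrongDual ℝ (BVL2 Ω)) (γ : E N → ℝ) :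
    Prop :=
  MemLp γ ∞ (bdryMeasure Ω) ∧
    ∀ (v : BVL2 Ω) (G : E N → E N), MemLp (toL2 v) ∞ (volOn Ω) →
      HasIntegrableWeakGradient Ω (toL2 v) G →
      ρ v + ∫ x in (Ω : Set (E N)), ⟪z x, G x⟫_ℝ = ∫ x, bdryTrace Ω (toL2 v) x * γ x ∂bdryMeasure Ω

/-- `z`, with divergence extended to `ρ` and normal traces `γ`, is an admissible vector field on
`(0,T) × Ω`. -/
structure IsAdmissibleField (Ω : Opens (E N)) (T : ℝ) (z : ℝ → E N → E N)
    (ρ : ℝ → StrongDual ℝ (BVL2 Ω)) (γ : ℝ → E N → ℝ) : Prop where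
  measurable : AEStronglyMeasurable (Function.uncurry z)
    ((volume.restrict (Ioo 0 T)).prod (volOn Ω))
  norm_le : ∀ᵐ p ∂(volume.restrict (Ioo 0 T)).prod (volOn Ω), ‖Function.uncurry z p‖ ≤ 1
  memDual : MemDualL1 T ρ
  /-- `ρ` extends the distributional divergence of `z`. -/
  extends_div : ∀ᵐ t ∂volume.restrict (Ioo 0 T), ∀ φ : 𝓓(Ω, ℝ),
    ρ t (toBV Ω φ) = - ∫ x in (Ω : Set (E N)), ⟪z t x, ∇ φ x⟫_ℝ
  normalTrace : ∀ᵐ t ∂volume.restrict (Ioo 0 T), IsNormalTrace Ω (z t) (ρ t) (γ t)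
  normalTrace_le : ∀ᵐ t ∂volume.restrict (Ioo 0 T), ∀ᵐ x ∂bdryMeasure Ω, |γ t x| ≤ 1
  /-- `(z(t), Dv)` is a Radon measure `μ`, and Green's formula holds. -/
  green : ∀ᵐ t ∂volume.restrict (Ioo 0 T), ∀ v : BVL2 Ω, ∃ μ : SignedMeasure (E N),
    (∀ ω : 𝓓(Ω, ℝ), pairing Ω (z t) (ρ t) v ω = ∫ᵛ x, ω x ∂•μ) ∧
    ρ t v + μ Ω = ∫ x, bdryTrace Ω (toL2 v) x * γ t x ∂bdryMeasure Ω

/-- `u` is a solution, with time derivative `ξ`, of `u' - Δ₁ u = f` in `(0,T) × Ω`, `u = 0` on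
`(0,T) × ∂Ω`, `u(0) = u₀`. -/
structure IsSolution (Ω : Opens (E N)) (T : ℝ) (f : ℝ → L2 Ω) (u₀ : L2 Ω) (u : ℝ → L2 Ω)
    (ξ : ℝ → StrongDual ℝ (BVL2 Ω)) : Prop where
  continuousOn : ContinuousOn u (Icc 0 T)
  initial : u 0 = u₀
  mem_bv : ∀ᵐ t ∂volume.restrict (Ioo 0 T), u t ∈ bvSubmodule Ω
  memL1 : MemL1 T fun t => toBV Ω (u t)
  mem_dual : MemDualL1AddL1 Ω T ξ
  timeDerivative : IsTimeDerivative Ω T u ξ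
  exists_field : ∃ (z : ℝ → E N → E N) (ρ : ℝ → StrongDual ℝ (BVL2 Ω)) (γ : ℝ → E N → ℝ),
    IsAdmissibleField Ω T z ρ γ ∧
    -- the equation `ξ(t) = div z(t) + f(t)` in the sense of distributions
    (∀ᵐ t ∂volume.restrict (Ioo 0 T), ∀ φ : 𝓓(Ω, ℝ),
      ξ t (toBV Ω φ) = - (∫ x in (Ω : Set (E N)), ⟪z t x, ∇ φ x⟫_ℝ) +
        ∫ x in (Ω : Set (E N)), f t x * φ x) ∧
    -- `(z(t), Du(t)) = |Du(t)|` as measures in `Ω`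
    (∀ᵐ t ∂volume.restrict (Ioo 0 T), ∀ ω : 𝓓(Ω, ℝ),
      pairing Ω (z t) (ρ t) (toBV Ω (u t)) ω = ∫ x, ω x ∂tv (toBV Ω (u t))) ∧
    -- `[z(t), ν] ∈ sign(-u(t))` a.e. on `∂Ω`
    (∀ᵐ t ∂volume.restrict (Ioo 0 T), ∀ᵐ x ∂bdryMeasure Ω,
      γ t x ∈ signSet (-bdryTrace Ω (u t) x))
  /-- The function `t ↦ ⟨⟨ξ(t), u(t)⟩⟩` is the distributional derivative of
  `t ↦ (1/2) ∫_Ω u(t)² dx`. -/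
  energy : LocallyIntegrableOn (fun t => ξ t (toBV Ω (u t))) (Ioo 0 T) ∧
    ∀ φ : 𝓓(timeInterval T, ℝ),
      ∫ t in Ioo 0 T, φ t * ξ t (toBV Ω (u t)) =
        - ∫ t in Ioo 0 T, deriv φ t * ∫ x in (Ω : Set (E N)), 1 / 2 * u t x ^ 2

/-- The function `Ψ_ε(t) = (1/ε) ∫_{t-ε}^t η(s) u(s) ds`, a Pettis integral in `BV(Ω) ∩ L²(Ω)`; the
function `η u` vanishes outside `(0,T)`. -/
def backwardAverage {Ω : Opens (E N)} {T : ℝ} (η : 𝓓(timeInterval T, ℝ)) (u : ℝ → L2 Ω) (ε t : ℝ) :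
    BVL2 Ω :=
  ε⁻¹ • pettisIntegral (fun s => η s • toBV Ω (u s)) (Ioo (t - ε) t)

end TVFlow

/-!
A Pettis integrable map into `BV(Ω) ∩ L²(Ω)` with integrable norm is Bochner integrable: on a
countable π-system generating the measurable sets of times, its Pettis integrals have gradients
dominated by one finite measure `μ`. The part of the gradient singular to `μ` is a bounded linear
operation, so it vanishes at almost every time, and the elements whose gradient is absolutely
continuous with respect to `μ` form a separable set, to which Pettis' measurability theorem applies.

The backward averages of `V = η u` therefore converge to `V` in `L¹` with values in
`BV(Ω) ∩ L²(Ω)`, by continuity of translations, and uniformly in `L²(Ω)`, since `V` is uniformly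
continuous there. The two summands of `ξ = ζ + g` are continuous for the first and the second
convergence, so the limit is `∫ η ⟨⟨ξ, u⟩⟩`, which the energy identity evaluates.
-/

namespace TVFlow

/-! ### Densities of vector measures -/

section Density

variable {α F : Type*} [MeasurableSpace α] {μ : Measure α} [NormedAddCommGroup F] [NormedSpace ℝ F]

lemma exists_withDensityᵥ_eq [FiniteDimensional ℝ F] [SigmaFinite μ] {D : VectorMeasure α F}
    (h : D.variation ≪ μ) : ∃ f, Integrable f μ ∧ μ.withDensityᵥ f = D := by
  have := FiniteDimensional.complete ℝ F
  let b := Module.finBasis ℝ F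
  let s i : SignedMeasure α :=
    D.mapRange (b.coord i).toAddMonoidHom (b.coord i).continuous_of_finiteDimensional
  have hs i A : s i A = b.repr (D A) i := rfl
  have hac i : s i ≪ᵥ μ.toENNRealVectorMeasure := by
    refine VectorMeasure.AbsolutelyContinuous.mk fun A hA hμ => ?_
    rw [Measure.toENNRealVectorMeasure_apply_measurable hA] at hμ
    rw [hs, (VectorMeasure.variation_apply_eq_zero hA).1 (h hμ) A Subset.rfl hA, map_zero,
      Finsupp.zero_apply]
  have hf : Integrable (fun x => ∑ i, (s i).rnDeriv μ x • b i) μ :=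
    integrable_finsetSum _ fun i _ => (SignedMeasure.integrable_rnDeriv _ _).smul_const _
  refine ⟨_, hf, VectorMeasure.ext fun A hA => ?_⟩
  rw [withDensityᵥ_apply hf hA, integral_finsetSum _ fun i _ =>
    ((SignedMeasure.integrable_rnDeriv _ _).smul_const _).integrableOn, ← b.sum_repr (D A)]
  refine Finset.sum_congr rfl fun i _ => ?_
  rw [integral_smul_const, ← withDensityᵥ_apply (SignedMeasure.integrable_rnDeriv _ _) hA,
    SignedMeasure.withDensityᵥ_rnDeriv_eq _ μ (hac i), hs]

lemma withDensityᵥ_coeFn_sub (f g : α →₁[μ] F) :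
    μ.withDensityᵥ (f - g : α →₁[μ] F) = μ.withDensityᵥ f - μ.withDensityᵥ g := by
  rw [← withDensityᵥ_sub (L1.integrable_coeFn f) (L1.integrable_coeFn g)]
  exact WithDensityᵥEq.congr_ae (Lp.coeFn_sub f g)

variable [CompleteSpace F]

lemma variation_withDensityᵥ_real_univ (f : α →₁[μ] F) :
    (μ.withDensityᵥ f).variation.real univ = ‖f‖ := by
  rw [Measure.variation_withDensityᵥ (L1.integrable_coeFn f), measureReal_def,
    withDensity_apply _ MeasurableSet.univ, Measure.restrict_univ, L1.norm_def]

lemma isFiniteMeasure_variation_withDensityᵥ (f : α →₁[μ] F) :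
    IsFiniteMeasure (μ.withDensityᵥ f).variation := by
  rw [Measure.variation_withDensityᵥ (L1.integrable_coeFn f)]
  exact isFiniteMeasure_withDensity (L1.integrable_coeFn f).2.ne

lemma continuous_integral_withDensityᵥ {φ : α → ℝ} {C : ℝ}
    (hφ : StronglyMeasurable φ) (hC : ∀ x, ‖φ x‖ ≤ C) :
    Continuous fun f : α →₁[μ] F => ∫ᵛ x, φ x ∂•(μ.withDensityᵥ f) := by
  have hφi (f : α →₁[μ] F) : (μ.withDensityᵥ f).Integrable φ :=
    have := isFiniteMeasure_variation_withDensityᵥ f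
    Integrable.of_bound hφ.aestronglyMeasurable C (.of_forall hC)
  refine (LipschitzWith.of_dist_le' (K := C * ‖ContinuousLinearMap.lsmul ℝ ℝ (E := F)‖)
    fun f g => ?_).continuous
  have := isFiniteMeasure_variation_withDensityᵥ (f - g)
  rw [dist_eq_norm, dist_eq_norm, ← VectorMeasure.integral_sub_vectorMeasure (hφi f) (hφi g),
    ← withDensityᵥ_coeFn_sub, ← variation_withDensityᵥ_real_univ]
  exact VectorMeasure.norm_integral_le_of_norm_le_const (.of_forall hC)

end Density

variable {N : ℕ} {Ω : Opens (E N)}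

open BVL2

/-! ### The space `BV(Ω) ∩ L²(Ω)` -/

lemma memLp_gradient_test (φ : 𝓓(Ω, ℝ)) (μ : Measure (E N)) [IsFiniteMeasureOnCompacts μ]
    (p : ℝ≥0∞) : MemLp (∇ φ) p μ := by
  have hc : Continuous (∇ φ) :=
    (InnerProductSpace.toDual ℝ (E N)).symm.continuous.comp (φ.contDiff.continuous_fderiv (by simp))
  exact hc.memLp_of_hasCompactSupport <| (φ.hasCompactSupport.fderiv ℝ).comp_left
    (g := (InnerProductSpace.toDual ℝ (E N)).symm) (map_zero _)

lemma continuous_integral_smul_gradient (φ : 𝓓(Ω, ℝ)) :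
    Continuous fun v : L2 Ω => ∫ x in (Ω : Set (E N)), v x • ∇ φ x := by
  let B := (ContinuousLinearMap.lsmul ℝ ℝ (E := E N)).lpPairing (volOn Ω) 2 2
  have hB (v : L2 Ω) : ∫ x in (Ω : Set (E N)), v x • ∇ φ x =
      B v ((memLp_gradient_test φ (volOn Ω) 2).toLp) := by
    rw [ContinuousLinearMap.lpPairing_eq_integral]
    refine integral_congr_ae ?_
    filter_upwards [(memLp_gradient_test φ (volOn Ω) 2).coeFn_toLp] with x hx
    rw [hx, ContinuousLinearMap.lsmul_apply]
  simp_rw [hB]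
  fun_prop

lemma isClosed_isGradMeasure_withDensityᵥ (Ω : Opens (E N)) (μ : Measure (E N)) :
    IsClosed {p : WithLp 1 ((E N →₁[μ] E N) × L2 Ω) |
      IsGradMeasure Ω p.snd (μ.withDensityᵥ p.fst)} := by
  have hiff (p : WithLp 1 ((E N →₁[μ] E N) × L2 Ω)) :
      IsGradMeasure Ω p.snd (μ.withDensityᵥ p.fst) ↔
        (∀ A, MeasurableSet A → ∫ x in A, p.fst x ∂μ = ∫ x in A ∩ Ω, p.fst x ∂μ) ∧
        ∀ φ : 𝓓(Ω, ℝ), ∫ x in (Ω : Set (E N)), p.snd x • ∇ φ x =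
          - ∫ᵛ x, φ x ∂•(μ.withDensityᵥ p.fst) := by
    have happly {A : Set (E N)} (hA : MeasurableSet A) :=
      withDensityᵥ_apply (L1.integrable_coeFn p.fst) hA
    have hinter {A : Set (E N)} (hA : MeasurableSet A) := happly (hA.inter Ω.isOpen.measurableSet)
    refine ⟨fun h => ⟨fun A hA => ?_, h.integral_eq⟩, fun h =>
      ⟨isFiniteMeasure_variation_withDensityᵥ _, fun A hA => ?_, h.2⟩⟩
    · rw [← happly hA, ← hinter hA, h.concentrated A hA]
    · rw [happly hA, hinter hA, h.1 A hA]
  have hfst : Continuous fun p : WithLp 1 ((E N →₁[μ] E N) × L2 Ω) => p.fst := by fun_prop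
  have hsnd : Continuous fun p : WithLp 1 ((E N →₁[μ] E N) × L2 Ω) => p.snd := by fun_prop
  simp only [hiff, ofPred_and, ofPred_forall]
  refine (isClosed_iInter fun A => isClosed_iInter fun _ => ?_).inter (isClosed_iInter fun φ => ?_)
  · exact isClosed_eq ((continuous_setIntegral A).comp hfst)
      ((continuous_setIntegral (A ∩ Ω)).comp hfst)
  · obtain ⟨C, hC⟩ := φ.continuous.bounded_above_of_compact_support φ.hasCompactSupport
    exact isClosed_eq ((continuous_integral_smul_gradient φ).comp hsnd)
      ((continuous_integral_withDensityᵥ φ.continuous.stronglyMeasurable hC).comp hfst).neg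

namespace BVL2

lemma grad_add (v w : BVL2 Ω) : grad (v + w) = grad v + grad w :=
  grad_eq (by simpa using (isGradMeasure_grad v).add (isGradMeasure_grad w))

lemma grad_smul (c : ℝ) (v : BVL2 Ω) : grad (c • v) = c • grad v :=
  grad_eq (by simpa using (isGradMeasure_grad v).smul c)

lemma grad_sub (v w : BVL2 Ω) : grad (v - w) = grad v - grad w := by
  rw [eq_sub_iff_add_eq, ← grad_add, sub_add_cancel]

lemma tv_univ (v : BVL2 Ω) : tv v univ = tv v Ω := by
  refine measure_eq_measure_of_null_sdiff (subset_univ _) ?_ |>.symm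
  rw [← compl_eq_univ_sdiff, tv,
    VectorMeasure.variation_apply_eq_zero Ω.isOpen.measurableSet.compl]
  intro A hA hAm
  rw [(isGradMeasure_grad v).concentrated A hAm,
    (disjoint_left.2 fun x hx => hA hx : Disjoint A (Ω : Set (E N))).inter_eq, VectorMeasure.empty]

lemma norm_eq (v : BVL2 Ω) : ‖v‖ = (tv v).real univ + ‖toL2 v‖ := by
  rw [norm_def, measureReal_def, measureReal_def, tv_univ]

lemma norm_toL2_le (v : BVL2 Ω) : ‖toL2 v‖ ≤ ‖v‖ := by
  rw [norm_eq]
  exact le_add_of_nonneg_left measureReal_nonneg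

lemma tv_real_le_norm (v : BVL2 Ω) (A : Set (E N)) : (tv v).real A ≤ ‖v‖ := by
  rw [norm_eq]
  exact (measureReal_mono (subset_univ A)).trans (le_add_of_nonneg_right (norm_nonneg _))

/-- The inclusion of `BV(Ω) ∩ L²(Ω)` in `L²(Ω)` as a continuous linear map. -/
def toL2L (Ω : Opens (E N)) : BVL2 Ω →L[ℝ] L2 Ω :=
  toL2.mkContinuous 1 fun v => by simpa using norm_toL2_le v

@[simp] lemma toL2L_apply (v : BVL2 Ω) : toL2L Ω v = toL2 v := rfl

/-- The pairs `(F, w) ∈ L¹(μ; ℝ^N) × L²(Ω)` such that `F μ` is the distributional gradient of `w`;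
the `ℓ¹` norm of the pair is the norm of `w` in `BV(Ω) ∩ L²(Ω)`. -/
abbrev GradDensity (Ω : Opens (E N)) (μ : Measure (E N)) : Type :=
  {p : WithLp 1 ((E N →₁[μ] E N) × L2 Ω) // IsGradMeasure Ω p.snd (μ.withDensityᵥ p.fst)}

/-- The element of `BV(Ω) ∩ L²(Ω)` with a given gradient density. -/
def ofGradDensity {μ : Measure (E N)} (p : GradDensity Ω μ) : BVL2 Ω :=
  ⟨p.1.snd, μ.withDensityᵥ p.1.fst, p.2⟩

lemma grad_ofGradDensity {μ : Measure (E N)} (p : GradDensity Ω μ) :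
    grad (ofGradDensity p) = μ.withDensityᵥ p.1.fst :=
  grad_eq p.2

lemma isometry_ofGradDensity (Ω : Opens (E N)) (μ : Measure (E N)) :
    Isometry (ofGradDensity : GradDensity Ω μ → BVL2 Ω) := by
  refine Isometry.of_dist_eq fun p q => ?_
  rw [Subtype.dist_eq, WithLp.prod_dist_eq_of_L1, dist_eq_norm, dist_eq_norm, dist_eq_norm, norm_eq,
    map_sub, tv, grad_sub, grad_ofGradDensity, grad_ofGradDensity, ← withDensityᵥ_coeFn_sub,
    variation_withDensityᵥ_real_univ]
  rfl

lemma range_ofGradDensity (Ω : Opens (E N)) (μ : Measure (E N)) [SigmaFinite μ] :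
    range (ofGradDensity : GradDensity Ω μ → BVL2 Ω) = {v | tv v ≪ μ} := by
  ext v
  constructor
  · rintro ⟨p, rfl⟩
    rw [mem_ofPred_eq, tv, grad_ofGradDensity,
      Measure.variation_withDensityᵥ (L1.integrable_coeFn _)]
    exact withDensity_absolutelyContinuous _ _
  · intro hv
    obtain ⟨F, hF, hFv⟩ := exists_withDensityᵥ_eq (μ := μ) (D := grad v) hv
    have hgrad : μ.withDensityᵥ (hF.toL1 F) = grad v :=
      (WithDensityᵥEq.congr_ae hF.coeFn_toL1).trans hFv
    refine ⟨⟨WithLp.toLp 1 (hF.toL1 F, toL2 v), ?_⟩, rfl⟩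
    change IsGradMeasure Ω (toL2 v) (μ.withDensityᵥ (hF.toL1 F))
    exact hgrad ▸ isGradMeasure_grad v

lemma isComplete_tv_absolutelyContinuous (Ω : Opens (E N)) (μ : Measure (E N))
    [SigmaFinite μ] : IsComplete {v : BVL2 Ω | tv v ≪ μ} := by
  have : CompleteSpace (GradDensity Ω μ) :=
    (isClosed_isGradMeasure_withDensityᵥ Ω μ).completeSpace_coe
  rw [← range_ofGradDensity]
  exact (isometry_ofGradDensity Ω μ).isUniformInducing.isComplete_range

lemma isSeparable_tv_absolutelyContinuous (Ω : Opens (E N)) (μ : Measure (E N))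
    [SigmaFinite μ] : IsSeparable {v : BVL2 Ω | tv v ≪ μ} := by
  have : Fact ((1 : ℝ≥0∞) ≠ ∞) := ⟨by simp⟩
  have : Fact ((2 : ℝ≥0∞) ≠ ∞) := ⟨by simp⟩
  rw [← range_ofGradDensity]
  exact isSeparable_range (isometry_ofGradDensity Ω μ).continuous

lemma exists_isFiniteMeasure_forall_tv_absolutelyContinuous {ι : Type*} [Countable ι]
    (v : ι → BVL2 Ω) : ∃ μ : Measure (E N), IsFiniteMeasure μ ∧ ∀ i, tv (v i) ≪ μ :=
  ⟨(Measure.sum fun i => tv (v i)).toFinite, inferInstance, fun i =>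
    (Measure.absolutelyContinuous_sum_right i .rfl).trans (absolutelyContinuous_toFinite _)⟩

instance : CompleteSpace (BVL2 Ω) := by
  refine Metric.complete_of_cauchySeq_tendsto fun v hv => ?_
  obtain ⟨μ, _, hμ⟩ := exists_isFiniteMeasure_forall_tv_absolutelyContinuous v
  obtain ⟨w, -, hw⟩ :=
    cauchySeq_tendsto_of_isComplete (isComplete_tv_absolutelyContinuous Ω μ) hμ hv
  exact ⟨w, hw⟩

end BVL2

/-! ### Pettis integrable maps to `BV(Ω) ∩ L²(Ω)` -/

section SignedMeasure

variable {α : Type*} [MeasurableSpace α]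

lemma singularPart_eq_zero_iff (s : SignedMeasure α) (μ : Measure α) [SigmaFinite μ] :
    s.singularPart μ = 0 ↔ s ≪ᵥ μ.toENNRealVectorMeasure := by
  have hdecomp := s.singularPart_add_withDensity_rnDeriv_eq μ
  constructor
  · intro h
    rw [h, zero_add] at hdecomp
    exact hdecomp ▸ Measure.withDensityᵥ_absolutelyContinuous μ (s.rnDeriv μ)
  · intro h
    rwa [s.withDensityᵥ_rnDeriv_eq μ h, add_eq_right] at hdecomp

lemma norm_singularPart_apply_le (s : SignedMeasure α) (μ : Measure α) (A : Set α) :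
    ‖s.singularPart μ A‖ ≤ s.variation.real univ := by
  have hle : (s.singularPart μ).totalVariation ≤ s.totalVariation := by
    rw [SignedMeasure.singularPart_totalVariation]
    exact add_le_add (Measure.singularPart_le _ _) (Measure.singularPart_le _ _)
  rw [← s.totalVariation_eq_variation]
  exact (SignedMeasure.norm_le_totalVariation _ A).trans
    (ENNReal.toReal_mono (measure_ne_top _ _) ((measure_mono (subset_univ A)).trans (hle univ)))

end SignedMeasure

namespace BVL2

/-- The distributional partial derivative `∂ᵢv`, a signed measure. -/
def partialDeriv (i : Fin N) (v : BVL2 Ω) : SignedMeasure (E N) :=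
  (grad v).mapRange (EuclideanSpace.proj i : StrongDual ℝ (E N))
    (EuclideanSpace.proj (𝕜 := ℝ) i).continuous

lemma partialDeriv_apply (i : Fin N) (v : BVL2 Ω) (A : Set (E N)) :
    partialDeriv i v A = grad v A i := rfl

lemma partialDeriv_add (i : Fin N) (v w : BVL2 Ω) :
    partialDeriv i (v + w) = partialDeriv i v + partialDeriv i w := by
  ext A
  simp [partialDeriv_apply, grad_add]

lemma partialDeriv_smul (i : Fin N) (c : ℝ) (v : BVL2 Ω) :
    partialDeriv i (c • v) = c • partialDeriv i v := by
  ext A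
  simp [partialDeriv_apply, grad_smul]

lemma variation_partialDeriv_le (i : Fin N) (v : BVL2 Ω) : (partialDeriv i v).variation ≤ tv v :=
  VectorMeasure.variation_le_of_forall_enorm_le fun A _ =>
    (enorm_le_iff_norm_le.2 (PiLp.norm_apply_le (grad v A) i)).trans
      (VectorMeasure.enorm_measure_le_variation _ _)

lemma tv_absolutelyContinuous_iff (v : BVL2 Ω) (μ : Measure (E N)) :
    tv v ≪ μ ↔ ∀ i, partialDeriv i v ≪ᵥ μ.toENNRealVectorMeasure := by
  constructor
  · refine fun h i => VectorMeasure.AbsolutelyContinuous.mk fun A hA hμA => ?_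
    rw [Measure.toENNRealVectorMeasure_apply_measurable hA] at hμA
    rw [partialDeriv_apply, (VectorMeasure.variation_apply_eq_zero hA).1 (h hμA) A .rfl hA,
      PiLp.zero_apply]
  · refine fun h => Measure.AbsolutelyContinuous.mk fun A hA hμA => ?_
    refine (VectorMeasure.variation_apply_eq_zero hA).2 fun B hBA hB => ?_
    ext i
    refine h i ?_
    rw [Measure.toENNRealVectorMeasure_apply_measurable hB]
    exact measure_mono_null hBA hμA

/-- The functional `v ↦ (∂ᵢv)ˢ(B)`, where `(∂ᵢv)ˢ` is the part of `∂ᵢv` singular with respect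
to `μ`. -/
def singularPartialDeriv (Ω : Opens (E N)) (μ : Measure (E N)) [SigmaFinite μ] (i : Fin N)
    (B : Set (E N)) : StrongDual ℝ (BVL2 Ω) :=
  LinearMap.mkContinuous
    { toFun v := (partialDeriv i v).singularPart μ B
      map_add' v w := by
        rw [partialDeriv_add, SignedMeasure.singularPart_add]
        rfl
      map_smul' c v := by
        rw [partialDeriv_smul, SignedMeasure.singularPart_smul]
        rfl }
    1 fun v => by
      rw [one_mul]
      exact (norm_singularPart_apply_le _ μ B).trans <|
        (ENNReal.toReal_mono (measure_ne_top _ _) (variation_partialDeriv_le i v univ)).trans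
          (tv_real_le_norm v univ)

lemma tv_absolutelyContinuous_iff_singularPartialDeriv (v : BVL2 Ω) (μ : Measure (E N))
    [SigmaFinite μ] {C : Set (Set (E N))} (hC : IsPiSystem C) (huniv : univ ∈ C)
    (hgen : (inferInstance : MeasurableSpace (E N)) = MeasurableSpace.generateFrom C) :
    tv v ≪ μ ↔ ∀ i, ∀ B ∈ C, singularPartialDeriv Ω μ i B v = 0 := by
  simp_rw [tv_absolutelyContinuous_iff, ← singularPart_eq_zero_iff]
  refine forall_congr' fun i => ⟨fun h B _ => ?_, fun h =>
    VectorMeasure.ext_of_generateFrom C h hgen hC (h univ huniv)⟩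
  change (partialDeriv i v).singularPart μ B = 0
  rw [h, zero_apply]

end BVL2

lemma exists_countable_isPiSystem_generateFrom (α : Type*) [m : MeasurableSpace α]
    [MeasurableSpace.CountablyGenerated α] :
    ∃ C : Set (Set α), C.Countable ∧ IsPiSystem C ∧ univ ∈ C ∧
      m = MeasurableSpace.generateFrom C := by
  have hC := isSetAlgebra_generateSetAlgebra (𝒜 := MeasurableSpace.countableGeneratingSet α)
  refine ⟨_, countable_generateSetAlgebra MeasurableSpace.countable_countableGeneratingSet,
    fun A hA B hB _ => hC.inter_mem hA hB, hC.univ_mem, ?_⟩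
  rw [generateFrom_generateSetAlgebra_eq, MeasurableSpace.generateFrom_countableGeneratingSet]

lemma ae_eq_zero_of_forall_setIntegral_eq_zero_of_isPiSystem {α F : Type*} [m : MeasurableSpace α]
    {μ : Measure α} [NormedAddCommGroup F] [NormedSpace ℝ F] [CompleteSpace F] {f : α → F}
    (hf : Integrable f μ) {C : Set (Set α)} (hC : IsPiSystem C) (huniv : univ ∈ C)
    (hgen : m = MeasurableSpace.generateFrom C) (h : ∀ A ∈ C, ∫ x in A, f x ∂μ = 0) :
    f =ᵐ[μ] 0 := by
  have hfC A (hA : A ∈ C) : μ.withDensityᵥ f A = 0 := by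
    rw [withDensityᵥ_apply hf (hgen ▸ MeasurableSpace.measurableSet_generateFrom hA), h A hA]
  refine hf.ae_eq_of_withDensityᵥ_eq (integrable_zero _ _ _) ?_
  rw [withDensityᵥ_zero]
  exact VectorMeasure.ext_of_generateFrom C hfC hgen hC (hfC univ huniv)

lemma PettisIntegrableOn.exists_countable_forall_dual {X : Type*} [NormedAddCommGroup X]
    [NormedSpace ℝ X] {U : ℝ → X} {S : Set ℝ} (hU : PettisIntegrableOn U S) (hS : MeasurableSet S) :
    ∃ V : Set X, V.Countable ∧ ∀ l : StrongDual ℝ X, (∀ v ∈ V, l v = 0) →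
      ∀ᵐ t ∂volume.restrict S, l (U t) = 0 := by
  obtain ⟨C, hCc, hC, huniv, hgen⟩ := exists_countable_isPiSystem_generateFrom ℝ
  have hCm A (hA : A ∈ C) : MeasurableSet A :=
    hgen ▸ MeasurableSpace.measurableSet_generateFrom hA
  have : Countable C := hCc.to_subtype
  choose v hv using fun A : C => hU (A ∩ S) ((hCm A A.2).inter hS) inter_subset_right
  refine ⟨range v, countable_range v, fun l hl => ?_⟩
  have hlU : IntegrableOn (fun t => l (U t)) S := by simpa using (hv ⟨univ, huniv⟩ l).1
  refine ae_eq_zero_of_forall_setIntegral_eq_zero_of_isPiSystem hlU hC huniv hgen fun A hA => ?_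
  rw [Measure.restrict_restrict (hCm A hA), (hv ⟨A, hA⟩ l).2, hl _ (mem_range_self _)]

lemma PettisIntegrableOn.exists_ae_tv_absolutelyContinuous {U : ℝ → BVL2 Ω} {S : Set ℝ}
    (hU : PettisIntegrableOn U S) (hS : MeasurableSet S) :
    ∃ μ : Measure (E N), IsFiniteMeasure μ ∧ ∀ᵐ t ∂volume.restrict S, tv (U t) ≪ μ := by
  obtain ⟨V, hVc, hV⟩ := hU.exists_countable_forall_dual hS
  have : Countable V := hVc.to_subtype
  obtain ⟨μ, hμ, hVμ⟩ :=
    exists_isFiniteMeasure_forall_tv_absolutelyContinuous (Subtype.val : V → BVL2 Ω)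
  obtain ⟨C, hCc, hC, huniv, hgen⟩ := exists_countable_isPiSystem_generateFrom (E N)
  have hiff (v : BVL2 Ω) :=
    tv_absolutelyContinuous_iff_singularPartialDeriv v μ hC huniv hgen
  refine ⟨μ, hμ, ?_⟩
  simp only [hiff, ae_all_iff, ae_ball_iff hCc]
  exact fun i B hB => hV _ fun v hv => (hiff v).1 (hVμ ⟨v, hv⟩) i B hB

lemma exists_countable_separating_dual (Z : Type*) [NormedAddCommGroup Z] [NormedSpace ℝ Z]
    [SecondCountableTopology Z] :
    ∃ L : Set (StrongDual ℝ Z), L.Countable ∧ ∀ x y, (∀ l ∈ L, l x = l y) → x = y := by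
  obtain ⟨L, hLc, hL⟩ := isOpen_iUnion_countable (fun l : StrongDual ℝ Z => {z | l z ≠ 0})
    fun l => isOpen_ne_fun l.continuous continuous_const
  refine ⟨L, hLc, fun x y hxy => ?_⟩
  by_contra hne
  obtain ⟨l, hl⟩ := SeparatingDual.exists_ne_zero (R := ℝ) (sub_ne_zero.2 hne)
  have hmem : x - y ∈ ⋃ l ∈ L, {z | l z ≠ 0} := hL ▸ mem_iUnion.2 ⟨l, hl⟩
  obtain ⟨l', hl', hne'⟩ := mem_iUnion₂.1 hmem
  exact hne' (by rw [map_sub, hxy l' hl', sub_self])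

lemma aemeasurable_of_forall_dual {α Z : Type*} [MeasurableSpace α] {μ : Measure α}
    [NormedAddCommGroup Z] [NormedSpace ℝ Z] [CompleteSpace Z] [SecondCountableTopology Z]
    [MeasurableSpace Z] [BorelSpace Z] {f : α → Z}
    (hf : ∀ l : StrongDual ℝ Z, AEMeasurable (fun a => l (f a)) μ) : AEMeasurable f μ := by
  obtain ⟨L, hLc, hL⟩ := exists_countable_separating_dual Z
  have : Countable L := hLc.to_subtype
  -- Lusin–Souslin: a continuous injection of Polish spaces is a measurable embedding
  have hemb : MeasurableEmbedding fun (z : Z) (l : L) => (l : StrongDual ℝ Z) z :=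
    Continuous.measurableEmbedding (by fun_prop) fun x y hxy =>
      hL x y fun l hl => congrFun hxy ⟨l, hl⟩
  exact hemb.aemeasurable_comp_iff.1 (aemeasurable_pi_iff.2 fun l => hf l)

lemma aestronglyMeasurable_of_forall_dual {α X : Type*} [MeasurableSpace α] {μ : Measure α}
    [NormedAddCommGroup X] [NormedSpace ℝ X] [CompleteSpace X] {f : α → X} {Y : Set X}
    (hY : IsSeparable Y) (hfY : ∀ᵐ a ∂μ, f a ∈ Y)
    (hf : ∀ l : StrongDual ℝ X, AEMeasurable (fun a => l (f a)) μ) : AEStronglyMeasurable f μ := by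
  let Z := (Submodule.span ℝ Y).topologicalClosure
  have : SeparableSpace Z := (hY.span (R := ℝ)).closure.separableSpace
  have : SecondCountableTopology Z := UniformSpace.secondCountable_of_separable Z
  have : CompleteSpace Z := (Submodule.isClosed_topologicalClosure _).completeSpace_coe
  have hYZ : Y ⊆ Z := Submodule.subset_span.trans (Submodule.le_topologicalClosure _)
  borelize ↥Z
  choose g hg using fun a => show ∃ z : Z, f a ∈ Z → z = f a from
    (em (f a ∈ Z)).elim (fun h => ⟨⟨f a, h⟩, fun _ => rfl⟩) fun h => ⟨0, fun h' => (h h').elim⟩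
  have hgf : (fun a => (g a : X)) =ᵐ[μ] f := hfY.mono fun a ha => hg a (hYZ ha)
  have hgm : AEMeasurable g μ := aemeasurable_of_forall_dual fun l => by
    obtain ⟨l', hl', -⟩ := exists_extension_norm_eq Z l
    refine (hf l').congr ?_
    filter_upwards [hgf] with a ha
    rw [← ha, hl']
  exact (continuous_subtype_val.comp_aestronglyMeasurable hgm.aestronglyMeasurable).congr hgf

lemma MemL1.integrableOn {T : ℝ} {U : ℝ → BVL2 Ω} (hU : MemL1 T U) : IntegrableOn U (Ioo 0 T) := by
  obtain ⟨μ, _, hμ⟩ := hU.2.exists_ae_tv_absolutelyContinuous measurableSet_Ioo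
  exact ⟨aestronglyMeasurable_of_forall_dual (isSeparable_tv_absolutelyContinuous Ω μ) hμ hU.1.1,
    hU.1.2⟩

/-! ### Backward averages -/

lemma tendsto_lintegral_enorm_comp_sub_sub {X : Type*} [NormedAddCommGroup X] {V : ℝ → X}
    (hV : Integrable V) :
    Tendsto (fun r => ∫⁻ t, ‖V (t - r) - V t‖ₑ) (𝓝 0) (𝓝 0) := by
  have : Fact ((1 : ℝ≥0∞) ≠ ∞) := ⟨ENNReal.one_ne_top⟩
  have hV1 : MemLp V 1 := memLp_one_iff_integrable.2 hV
  have hcont : Continuous fun r : ℝ => DomAddAct.mk (-r) +ᵥ hV1.toLp V := by fun_prop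
  have hlim : Tendsto (fun r : ℝ => edist (DomAddAct.mk (-r) +ᵥ hV1.toLp V) (hV1.toLp V))
      (𝓝 0) (𝓝 0) := by
    simpa using (hcont.edist (continuous_const (y := hV1.toLp V))).tendsto 0
  refine hlim.congr fun r => ?_
  rw [DomAddAct.mk_vadd_toLp, Lp.edist_toLp_toLp, eLpNorm_one_eq_lintegral_enorm]
  simp [sub_eq_neg_add]

lemma inv_mul_setLIntegral_Ioo_le {G : ℝ → ℝ≥0∞} {κ : ℝ≥0∞} {ε : ℝ} (hε : 0 < ε)
    (hG : ∀ r ∈ Ioo 0 ε, G r ≤ κ) : (ENNReal.ofReal ε)⁻¹ * ∫⁻ r in Ioo 0 ε, G r ≤ κ :=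
  calc (ENNReal.ofReal ε)⁻¹ * ∫⁻ r in Ioo 0 ε, G r
      ≤ (ENNReal.ofReal ε)⁻¹ * (κ * ENNReal.ofReal ε) := by
        gcongr
        simpa using setLIntegral_mono' (μ := volume) measurableSet_Ioo hG
    _ = κ := by
        rw [mul_comm κ, ENNReal.inv_mul_cancel_left (by simpa) ENNReal.ofReal_ne_top]

section BackwardMean

variable {X : Type*} [NormedAddCommGroup X] [NormedSpace ℝ X]

/-- The backward average `(1/ε) ∫_{t-ε}^t V(s) ds`, as a Bochner integral. -/
def backwardMean (ε : ℝ) (V : ℝ → X) (t : ℝ) : X := ε⁻¹ • ∫ s in Ioo (t - ε) t, V s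

lemma continuous_backwardMean {V : ℝ → X} (hV : LocallyIntegrable V) {ε : ℝ} (hε : 0 < ε) :
    Continuous (backwardMean ε V) := by
  have hint (a b : ℝ) : IntervalIntegrable V volume a b :=
    (hV.integrableOn_isCompact isCompact_uIcc).intervalIntegrable
  have hprim : Continuous fun t => ∫ s in (0 : ℝ)..t, V s :=
    intervalIntegral.continuous_primitive hint 0
  have heq : backwardMean ε V =
      fun t => ε⁻¹ • ((∫ s in (0 : ℝ)..t, V s) - ∫ s in (0 : ℝ)..(t - ε), V s) := by
    ext t
    rw [backwardMean, intervalIntegral.integral_interval_sub_left (hint _ _) (hint _ _),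
      intervalIntegral.integral_of_le (by linarith), integral_Ioc_eq_integral_Ioo]
  rw [heq]
  exact (hprim.sub (hprim.comp (continuous_id.sub continuous_const))).const_smul _

lemma norm_backwardMean_le {V : ℝ → X} (hV : Integrable V) {ε : ℝ} (hε : 0 < ε) (t : ℝ) :
    ‖backwardMean ε V t‖ ≤ ε⁻¹ * ∫ s, ‖V s‖ := by
  rw [backwardMean, norm_smul, Real.norm_of_nonneg (inv_nonneg.2 hε.le)]
  gcongr
  exact (norm_integral_le_integral_norm _).trans
    (setIntegral_le_integral hV.norm (.of_forall fun _ => norm_nonneg _))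

lemma backwardMean_congr_ae {V W : ℝ → X} (h : V =ᵐ[volume] W) (ε : ℝ) :
    backwardMean ε V = backwardMean ε W := by
  ext t
  rw [backwardMean, backwardMean, integral_congr_ae (ae_restrict_of_ae h)]

lemma map_backwardMean {Y : Type*} [NormedAddCommGroup Y] [NormedSpace ℝ Y] [CompleteSpace X]
    [CompleteSpace Y] (L : X →L[ℝ] Y) {V : ℝ → X} (hV : Integrable V) (ε t : ℝ) :
    L (backwardMean ε V t) = backwardMean ε (fun s => L (V s)) t := by
  rw [backwardMean, backwardMean, map_smul, L.integral_comp_comm hV.integrableOn]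

lemma backwardMean_eq_smul_integral_comp_sub (ε : ℝ) (V : ℝ → X) (t : ℝ) :
    backwardMean ε V t = ε⁻¹ • ∫ r in Ioo 0 ε, V (t - r) := by
  rw [backwardMean, ← show (fun r => t - r) ⁻¹' Ioo (t - ε) t = Ioo 0 ε by simp,
    (Measure.measurePreserving_sub_left volume t).setIntegral_preimage_emb
      (Homeomorph.subLeft t).measurableEmbedding]

lemma enorm_backwardMean_sub_le [CompleteSpace X] {V : ℝ → X} (hV : LocallyIntegrable V) {ε : ℝ}
    (hε : 0 < ε) (t : ℝ) : ‖backwardMean ε V t - V t‖ₑ ≤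
      (ENNReal.ofReal ε)⁻¹ * ∫⁻ r in Ioo 0 ε, ‖V (t - r) - V t‖ₑ := by
  have hint : IntegrableOn (fun r => V (t - r)) (Ioo 0 ε) := by
    rw [← show (fun r => t - r) ⁻¹' Ioo (t - ε) t = Ioo 0 ε by simp]
    exact ((Measure.measurePreserving_sub_left volume t).integrableOn_comp_preimage
      (Homeomorph.subLeft t).measurableEmbedding).2
      ((hV.integrableOn_isCompact isCompact_Icc).mono_set Ioo_subset_Icc_self)
  have heq : backwardMean ε V t - V t = ε⁻¹ • ∫ r in Ioo 0 ε, (V (t - r) - V t) := by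
    rw [integral_sub hint (integrable_const _), setIntegral_const,
      Real.volume_real_Ioo_of_le hε.le, sub_zero, smul_sub, inv_smul_smul₀ hε.ne',
      backwardMean_eq_smul_integral_comp_sub]
  rw [heq, enorm_smul, Real.enorm_of_nonneg (inv_nonneg.2 hε.le), ENNReal.ofReal_inv_of_pos hε]
  gcongr
  exact enorm_integral_le_lintegral_enorm _

lemma tendstoUniformly_backwardMean [CompleteSpace X] {W : ℝ → X} (hW : UniformContinuous W) :
    TendstoUniformly (fun ε => backwardMean ε W) W (𝓝[>] 0) := by
  refine Metric.tendstoUniformly_iff.2 fun δ hδ => ?_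
  obtain ⟨r₀, hr₀, hWδ⟩ := Metric.uniformContinuous_iff.1 hW (δ / 2) (half_pos hδ)
  filter_upwards [Ioo_mem_nhdsGT hr₀] with ε hε t
  have hle : ‖backwardMean ε W t - W t‖ₑ ≤ ENNReal.ofReal (δ / 2) :=
    (enorm_backwardMean_sub_le hW.continuous.locallyIntegrable hε.1 t).trans
      (inv_mul_setLIntegral_Ioo_le hε.1 fun r hr => by
        rw [← ofReal_norm, ← dist_eq_norm]
        gcongr
        refine (hWδ ?_).le
        rw [Real.dist_eq, sub_sub_cancel_left, abs_neg, abs_of_pos hr.1]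
        exact hr.2.trans hε.2)
  rw [← ofReal_norm, ENNReal.ofReal_le_ofReal_iff (half_pos hδ).le] at hle
  rw [dist_comm, dist_eq_norm]
  linarith

lemma tendsto_lintegral_enorm_backwardMean_sub [CompleteSpace X] {V : ℝ → X} (hV : Integrable V) :
    Tendsto (fun ε => ∫⁻ t, ‖backwardMean ε V t - V t‖ₑ) (𝓝[>] 0) (𝓝 0) := by
  refine ENNReal.tendsto_nhds_zero.2 fun κ hκ => ?_
  obtain ⟨r₀, hr₀, hr₀κ⟩ := Metric.eventually_nhds_iff_ball.1
    (ENNReal.tendsto_nhds_zero.1 (tendsto_lintegral_enorm_comp_sub_sub hV) κ hκ)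
  filter_upwards [Ioo_mem_nhdsGT hr₀] with ε hε
  have hmeas : AEMeasurable (Function.uncurry fun t r => ‖V (t - r) - V t‖ₑ)
      (volume.prod (volume.restrict (Ioo 0 ε))) := by
    have hac : volume.prod (volume.restrict (Ioo 0 ε)) ≪ (volume.prod volume : Measure (ℝ × ℝ)) :=
      .prod .rfl Measure.restrict_le_self.absolutelyContinuous
    have hsub : AEStronglyMeasurable (fun p : ℝ × ℝ => V (p.1 - p.2)) (volume.prod volume) :=
      hV.1.comp_quasiMeasurePreserving (quasiMeasurePreserving_sub volume volume)
    exact ((hsub.sub hV.1.comp_fst).mono_ac hac).enorm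
  calc ∫⁻ t, ‖backwardMean ε V t - V t‖ₑ
      ≤ ∫⁻ t, (ENNReal.ofReal ε)⁻¹ * ∫⁻ r in Ioo 0 ε, ‖V (t - r) - V t‖ₑ :=
        lintegral_mono fun t => enorm_backwardMean_sub_le hV.locallyIntegrable hε.1 t
    _ = (ENNReal.ofReal ε)⁻¹ * ∫⁻ r in Ioo 0 ε, ∫⁻ t, ‖V (t - r) - V t‖ₑ := by
        rw [lintegral_const_mul' _ _ (by simpa using hε.1), lintegral_lintegral_swap hmeas]
    _ ≤ κ := inv_mul_setLIntegral_Ioo_le hε.1 fun r hr => hr₀κ r (by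
        rw [mem_ball_zero_iff, Real.norm_of_nonneg hr.1.le]
        exact hr.2.trans hε.2)

end BackwardMean

/-! ### Duality pairings -/

lemma aemeasurable_dual_apply {α X : Type*} [MeasurableSpace α] {μ : Measure α}
    [NormedAddCommGroup X] [NormedSpace ℝ X] {ζ : α → StrongDual ℝ X} {Φ : α → X}
    (hζ : ∀ v : X, AEMeasurable (fun a => ζ a v) μ) (hΦ : AEStronglyMeasurable Φ μ) :
    AEMeasurable (fun a => ζ a (Φ a)) μ := by
  have hsimple (s : SimpleFunc α X) : AEMeasurable (fun a => ζ a (s a)) μ := by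
    classical
    have heq : (fun a => ζ a (s a)) =
        fun a => ∑ y ∈ s.range, (s ⁻¹' {y}).indicator (fun b => ζ b y) a := by
      ext a
      simp [indicator_apply]
    rw [heq]
    exact Finset.aemeasurable_fun_sum _ fun y _ => (hζ y).indicator (s.measurableSet_fiber y)
  obtain ⟨Φ', hΦ', hΦΦ'⟩ := hΦ
  have hlim : AEMeasurable (fun a => ζ a (Φ' a)) μ :=
    aemeasurable_of_tendsto_metrizable_ae' (fun n => hsimple (hΦ'.approx n)) <| .of_forall fun a =>
      ((ζ a).continuous.tendsto _).comp (hΦ'.tendsto_approx a)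
  exact hlim.congr (hΦΦ'.mono fun a ha => by simp only [ha])

lemma integral_mul_eq_inner (g w : L2 Ω) :
    ∫ x in (Ω : Set (E N)), g x * w x = ⟪g, w⟫_ℝ := by
  simp [L2.inner_def, mul_comm]

section Pairing

variable {T : ℝ} {ξ : ℝ → StrongDual ℝ (BVL2 Ω)}

lemma MemDualL1AddL1.aestronglyMeasurable_apply (hξ : MemDualL1AddL1 Ω T ξ) {Φ : ℝ → BVL2 Ω}
    (hΦ : AEStronglyMeasurable Φ (volume.restrict (Ioo 0 T))) :
    AEStronglyMeasurable (fun t => ξ t (Φ t)) (volume.restrict (Ioo 0 T)) := by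
  obtain ⟨ζ, g, ⟨hζ, -⟩, hg, hξζg⟩ := hξ
  refine (aemeasurable_dual_apply (fun v => ?_) hΦ).aestronglyMeasurable
  have hgv := hg.1.inner (𝕜 := ℝ) (aestronglyMeasurable_const (b := toL2 v))
  refine ((hζ v).add hgv.aemeasurable).congr (hξζg.mono fun t ht => ?_)
  simp only [Pi.add_apply, ht, integral_mul_eq_inner]

lemma MemDualL1AddL1.exists_lintegral_enorm_apply_le (hξ : MemDualL1AddL1 Ω T ξ) :
    ∃ K M : ℝ≥0, ∀ Φ : ℝ → BVL2 Ω, ∫⁻ t in Ioo 0 T, ‖ξ t (Φ t)‖ₑ ≤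
      K * (∫⁻ t in Ioo 0 T, ‖Φ t‖ₑ) +
        M * eLpNormEssSup (fun t => toL2 (Φ t)) (volume.restrict (Ioo 0 T)) := by
  obtain ⟨ζ, g, ⟨-, K, hζK⟩, hg, hξζg⟩ := hξ
  refine ⟨K.toNNReal, (∫⁻ t in Ioo 0 T, ‖g t‖ₑ).toNNReal, fun Φ => ?_⟩
  rw [ENNReal.coe_toNNReal hg.2.ne]
  set S := eLpNormEssSup (fun t => toL2 (Φ t)) (volume.restrict (Ioo 0 T))
  calc ∫⁻ t in Ioo 0 T, ‖ξ t (Φ t)‖ₑ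
      ≤ ∫⁻ t in Ioo 0 T, (K.toNNReal * ‖Φ t‖ₑ + ‖g t‖ₑ * S) := by
        refine lintegral_mono_ae ?_
        filter_upwards [hξζg, hζK, enorm_ae_le_eLpNormEssSup (fun t => toL2 (Φ t)) _]
          with t ht hKt hSt
        rw [ht, integral_mul_eq_inner]
        have hζt : ‖ζ t‖ₑ ≤ K.toNNReal := by
          rw [← ofReal_norm]
          exact ENNReal.ofReal_le_ofReal hKt
        have hinner : ‖⟪g t, toL2 (Φ t)⟫_ℝ‖ₑ ≤ ‖g t‖ₑ * ‖toL2 (Φ t)‖ₑ := by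
          rw [← ofReal_norm, ← ofReal_norm, ← ofReal_norm, ← ENNReal.ofReal_mul (norm_nonneg _)]
          exact ENNReal.ofReal_le_ofReal (norm_inner_le_norm _ _)
        calc ‖ζ t (Φ t) + ⟪g t, toL2 (Φ t)⟫_ℝ‖ₑ
            ≤ ‖ζ t (Φ t)‖ₑ + ‖⟪g t, toL2 (Φ t)⟫_ℝ‖ₑ := enorm_add_le _ _
          _ ≤ ‖ζ t‖ₑ * ‖Φ t‖ₑ + ‖g t‖ₑ * ‖toL2 (Φ t)‖ₑ :=
              add_le_add ((ζ t).le_opENorm _) hinner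
          _ ≤ K.toNNReal * ‖Φ t‖ₑ + ‖g t‖ₑ * S := by gcongr
    _ = K.toNNReal * (∫⁻ t in Ioo 0 T, ‖Φ t‖ₑ) + (∫⁻ t in Ioo 0 T, ‖g t‖ₑ) * S := by
        rw [lintegral_add_right' _ (hg.1.enorm.mul_const _),
          lintegral_const_mul' _ _ ENNReal.coe_ne_top, lintegral_mul_const'' _ hg.1.enorm]

lemma MemDualL1AddL1.integrableOn_apply (hξ : MemDualL1AddL1 Ω T ξ) {Φ : ℝ → BVL2 Ω}
    (hΦ : IntegrableOn Φ (Ioo 0 T))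
    (hΦ2 : eLpNormEssSup (fun t => toL2 (Φ t)) (volume.restrict (Ioo 0 T)) ≠ ∞) :
    IntegrableOn (fun t => ξ t (Φ t)) (Ioo 0 T) := by
  obtain ⟨K, M, hKM⟩ := hξ.exists_lintegral_enorm_apply_le
  exact ⟨hξ.aestronglyMeasurable_apply hΦ.1, (hKM Φ).trans_lt <| ENNReal.add_lt_top.2
    ⟨ENNReal.mul_lt_top ENNReal.coe_lt_top hΦ.2, ENNReal.mul_lt_top ENNReal.coe_lt_top hΦ2.lt_top⟩⟩

lemma MemDualL1AddL1.tendsto_integral_apply (hξ : MemDualL1AddL1 Ω T ξ) {ι : Type*} {l : Filter ι}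
    {Φ : ι → ℝ → BVL2 Ω} {V : ℝ → BVL2 Ω}
    (hΦ : ∀ᶠ i in l, IntegrableOn (fun t => ξ t (Φ i t)) (Ioo 0 T))
    (hV : AEStronglyMeasurable V (volume.restrict (Ioo 0 T)))
    (h1 : Tendsto (fun i => ∫⁻ t in Ioo 0 T, ‖Φ i t - V t‖ₑ) l (𝓝 0))
    (h2 : Tendsto (fun i => eLpNormEssSup (fun t => toL2 (Φ i t - V t)) (volume.restrict (Ioo 0 T)))
      l (𝓝 0)) :
    Tendsto (fun i => ∫ t in Ioo 0 T, ξ t (Φ i t)) l (𝓝 (∫ t in Ioo 0 T, ξ t (V t))) := by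
  obtain ⟨K, M, hKM⟩ := hξ.exists_lintegral_enorm_apply_le
  refine tendsto_integral_of_L1 _ (hξ.aestronglyMeasurable_apply hV) hΦ ?_
  have hbound : Tendsto (fun i => K * (∫⁻ t in Ioo 0 T, ‖Φ i t - V t‖ₑ) +
      M * eLpNormEssSup (fun t => toL2 (Φ i t - V t)) (volume.restrict (Ioo 0 T))) l (𝓝 0) := by
    simpa using (ENNReal.Tendsto.const_mul h1 (.inr ENNReal.coe_ne_top)).add
      (ENNReal.Tendsto.const_mul h2 (.inr ENNReal.coe_ne_top))
  refine tendsto_of_tendsto_of_tendsto_of_le_of_le tendsto_const_nhds hbound (fun _ => zero_le)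
    fun i => ?_
  simpa only [map_sub] using hKM fun t => Φ i t - V t

lemma MemDualL1AddL1.integrableOn_apply_backwardMean (hξ : MemDualL1AddL1 Ω T ξ) {V : ℝ → BVL2 Ω}
    (hV : Integrable V) {ε : ℝ} (hε : 0 < ε) :
    IntegrableOn (fun t => ξ t (backwardMean ε V t)) (Ioo 0 T) := by
  refine hξ.integrableOn_apply
    ((continuous_backwardMean hV.locallyIntegrable hε).integrableOn_Icc.mono_set
      Ioo_subset_Icc_self) (eLpNormEssSup_lt_top_of_ae_bound (C := ε⁻¹ * ∫ s, ‖V s‖) ?_).ne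
  exact .of_forall fun t => (norm_toL2_le _).trans (norm_backwardMean_le hV hε t)

lemma MemDualL1AddL1.tendsto_integral_backwardMean (hξ : MemDualL1AddL1 Ω T ξ) {V : ℝ → BVL2 Ω}
    (hV : Integrable V) {W : ℝ → L2 Ω} (hVW : ∀ᵐ t, toL2 (V t) = W t)
    (hW : UniformContinuous W) :
    Tendsto (fun ε => ∫ t in Ioo 0 T, ξ t (backwardMean ε V t)) (𝓝[>] 0)
      (𝓝 (∫ t in Ioo 0 T, ξ t (V t))) := by
  refine hξ.tendsto_integral_apply ?_ hV.1.restrict ?_ ?_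
  · exact eventually_mem_nhdsWithin.mono fun ε hε => hξ.integrableOn_apply_backwardMean hV hε
  · exact tendsto_of_tendsto_of_tendsto_of_le_of_le tendsto_const_nhds
      (tendsto_lintegral_enorm_backwardMean_sub hV) (fun _ => zero_le)
      fun _ => setLIntegral_le_lintegral _ _
  · refine ENNReal.tendsto_nhds_zero.2 fun κ hκ => ?_
    filter_upwards [EMetric.tendstoUniformly_iff.1 (tendstoUniformly_backwardMean hW) κ hκ]
      with ε hε
    refine eLpNormEssSup_le_of_ae_enorm_bound (ae_restrict_of_ae (hVW.mono fun t ht => ?_))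
    have hmean : toL2 (backwardMean ε V t) = backwardMean ε W t := by
      rw [← backwardMean_congr_ae hVW, ← toL2L_apply, map_backwardMean _ hV]
      rfl
    rw [map_sub, hmean, ht, ← edist_eq_enorm_sub, edist_comm]
    exact (hε t).le

end Pairing

/-! ### Maps weighted by a test function of time -/

section Pettis

variable {X : Type*} [NormedAddCommGroup X] [NormedSpace ℝ X]

lemma HasPettisIntegral.pettisIntegral_eq {U : ℝ → X} {S : Set ℝ} {v : X}
    (h : HasPettisIntegral U S v) : pettisIntegral U S = v := by
  have hex : ∃ w, HasPettisIntegral U S w := ⟨v, h⟩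
  rw [pettisIntegral, dif_pos hex]
  exact (SeparatingDual.eq_iff_forall_dual_eq (R := ℝ)).2 fun l =>
    (hex.choose_spec l).2.symm.trans (h l).2

lemma hasPettisIntegral_integral [CompleteSpace X] {U : ℝ → X} {S : Set ℝ}
    (h : IntegrableOn U S) : HasPettisIntegral U S (∫ t in S, U t) :=
  fun l => ⟨l.integrable_comp h, l.integral_comp_comm h⟩

end Pettis

lemma toL2_toBV {w : L2 Ω} (hw : w ∈ bvSubmodule Ω) : toL2 (toBV Ω w) = w := by
  have hex : ∃ v : BVL2 Ω, toL2 v =ᵐ[volOn Ω] w := ⟨⟨w, hw⟩, .rfl⟩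
  rw [toBV, dif_pos hex]
  exact Lp.ext hex.choose_spec

section TestFunction

variable {T : ℝ} (η : 𝓓(timeInterval T, ℝ))

lemma testFunction_eq_zero_of_notMem {t : ℝ} (ht : t ∉ Ioo 0 T) : η t = 0 :=
  image_eq_zero_of_notMem_tsupport fun h => ht (η.tsupport_subset h)

variable {X : Type*} [NormedAddCommGroup X] [NormedSpace ℝ X]

lemma integrable_testFunction_smul {U : ℝ → X} (hU : IntegrableOn U (Ioo 0 T)) :
    Integrable fun s => η s • U s := by
  obtain ⟨C, hC⟩ := η.continuous.bounded_above_of_compact_support η.hasCompactSupport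
  have hηU : IntegrableOn (fun s => η s • U s) (Ioo 0 T) :=
    hU.bdd_smul C η.continuous.aestronglyMeasurable (.of_forall hC)
  refine (integrableOn_iff_integrable_of_support_subset fun t ht => ?_).1 hηU
  by_contra hmem
  exact ht (by simp [testFunction_eq_zero_of_notMem η hmem])

lemma uniformContinuous_testFunction_smul {w : ℝ → X} (hw : ContinuousOn w (Ioo 0 T)) :
    UniformContinuous fun s => η s • w s := by
  have hcont : Continuous fun s => η s • w s := by
    refine continuous_of_tsupport fun t ht => ?_
    have hmem : t ∈ Ioo 0 T := η.tsupport_subset (tsupport_smul_subset_left η w ht)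
    exact η.continuous.continuousAt.smul (hw.continuousAt (isOpen_Ioo.mem_nhds hmem))
  exact (η.hasCompactSupport.smul_right (f' := w)).uniformContinuous_of_continuous hcont

lemma ae_toL2_testFunction_smul_toBV {u : ℝ → L2 Ω}
    (hu : ∀ᵐ t ∂volume.restrict (Ioo 0 T), u t ∈ bvSubmodule Ω) :
    ∀ᵐ t, toL2 (η t • toBV Ω (u t)) = η t • u t := by
  filter_upwards [(ae_restrict_iff' measurableSet_Ioo).1 hu] with t ht
  rw [map_smul]
  by_cases hmem : t ∈ Ioo 0 T
  · rw [toL2_toBV (ht hmem)]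
  · simp only [testFunction_eq_zero_of_notMem η hmem, zero_smul]

lemma backwardAverage_eq_backwardMean {u : ℝ → L2 Ω}
    (hu : IntegrableOn (fun t => toBV Ω (u t)) (Ioo 0 T)) (ε : ℝ) :
    backwardAverage η u ε = backwardMean ε fun s => η s • toBV Ω (u s) := by
  ext1 t
  rw [backwardAverage, backwardMean, (hasPettisIntegral_integral
    (integrable_testFunction_smul η hu).integrableOn).pettisIntegral_eq]

end TestFunction

end TVFlow

theorem mainTheorem3_general {N : ℕ} (Ω : Opens (TVFlow.E N)) {T : ℝ} (u : ℝ → TVFlow.L2 Ω)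
    (ξ : ℝ → StrongDual ℝ (TVFlow.BVL2 Ω)) (hcont : ContinuousOn u (Ioo 0 T))
    (hbv : ∀ᵐ t ∂volume.restrict (Ioo 0 T), u t ∈ TVFlow.bvSubmodule Ω)
    (hu : TVFlow.MemL1 T fun t => TVFlow.toBV Ω (u t)) (hξ : TVFlow.MemDualL1AddL1 Ω T ξ)
    (η : 𝓓(TVFlow.timeInterval T, ℝ)) :
    (∀ ε > 0,
      (∀ t ∈ Ioo 0 T,
        TVFlow.PettisIntegrableOn (fun s => η s • TVFlow.toBV Ω (u s)) (Ioo (t - ε) t)) ∧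
      IntegrableOn (fun t => ξ t (TVFlow.backwardAverage η u ε t)) (Ioo 0 T)) ∧
    Tendsto (fun ε => ∫ t in Ioo 0 T, ξ t (TVFlow.backwardAverage η u ε t)) (𝓝[>] 0)
      (𝓝 (∫ t in Ioo 0 T, η t * ξ t (TVFlow.toBV Ω (u t)))) := by
  open TVFlow in
  have hV : Integrable fun s => η s • toBV Ω (u s) :=
    integrable_testFunction_smul η hu.integrableOn
  simp only [backwardAverage_eq_backwardMean η hu.integrableOn, ← smul_eq_mul, ← map_smul]
  refine ⟨fun ε hε => ⟨fun t _ A _ _ => ⟨_, hasPettisIntegral_integral hV.integrableOn⟩,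
    hξ.integrableOn_apply_backwardMean hV hε⟩, ?_⟩
  exact hξ.tendsto_integral_backwardMean hV (ae_toL2_testFunction_smul_toBV η hbv)
    (uniformContinuous_testFunction_smul η hcont)

theorem mainTheorem3 {N : ℕ} (hN : 2 ≤ N) (Ω : Opens (TVFlow.E N))
    (hΩ : Bornology.IsBounded (Ω : Set (TVFlow.E N))) (hlip : TVFlow.HasLipschitzBoundary Ω)
    {T : ℝ} (hT : 0 < T) (f : ℝ → TVFlow.L2 Ω) (hf : IntegrableOn f (Ioo 0 T)) (u₀ : TVFlow.L2 Ω)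
    (u : ℝ → TVFlow.L2 Ω) (ξ : ℝ → StrongDual ℝ (TVFlow.BVL2 Ω))
    (hu : TVFlow.IsSolution Ω T f u₀ u ξ)
    (η : 𝓓(TVFlow.timeInterval T, ℝ)) (hη : ∀ t, 0 ≤ η t) :
    (∀ ε > 0,
      (∀ t ∈ Ioo 0 T,
        TVFlow.PettisIntegrableOn (fun s => η s • TVFlow.toBV Ω (u s)) (Ioo (t - ε) t)) ∧
      IntegrableOn (fun t => ξ t (TVFlow.backwardAverage η u ε t)) (Ioo 0 T)) ∧
    Tendsto (fun ε => ∫ t in Ioo 0 T, ξ t (TVFlow.backwardAverage η u ε t)) (𝓝[>] 0)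
      (𝓝 (- ∫ t in Ioo 0 T, deriv η t * ∫ x in (Ω : Set (TVFlow.E N)), 1 / 2 * u t x ^ 2)) := by
  rw [← hu.energy.2 η]
  exact mainTheorem3_general Ω u ξ (hu.continuousOn.mono Ioo_subset_Icc_self) hu.mem_bv hu.memL1
    hu.mem_dual η
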